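/- Let $f:\mathbb R^n\to\mathbb R$ be twice continuously differentiable and $\lambda$-strongly convex with $\lambda>0$, i.e. $f(\alpha x+(1-\alpha)x')\le \alpha f(x)+(1-\alpha)f(x')-\frac{\alpha(1-\alpha)\lambda}{2}\|x-x'\|^2$ for all $x,x'$ and $\alpha\in[0,1]$, and let its Hessian be $\gamma$-Lipschitz in the spectral norm, $\gamma>0$. Let $x_*$ be the minimizer of $f$, let $\mu_u\ge 0$, $R_0>0$, $\|z_0-x_*\|\le R_0$, and put $R_s=R_0/2^s$. *AINCR with the convex parameters.* Put $\alpha_t=\frac{3}{t+3}$, $A_t=\prod_{i=1}^t(1-\alpha_i)$, $\bar\mu_t=2\mu_u(t+2)$, $\beta=96\gamma$, $\eta=4\gamma$, and $\tilde f_{\eta}(x;w)=f(w)+\langle\nabla f(w),x-w\rangle+\frac12\langle H(x-w),x-w\rangle+\frac{\eta}{6}\|x-w\|^3$, where $H$ is the Hessian approximation used at $w$. Given $x_0$, set $w_0=x_0$, $x_1\in\arg\min_x\tilde f_\gamma(x;x_0)$, $\phi_1(x)=f(x_1)+\frac{\bar\mu_0}{2}\|x-x_0\|^2+\frac{\beta}{6}\|x-x_0\|^3$,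 $y_1\in\arg\min\phi_1$, and for $t\ge1$ $$w_t=(1-\alpha_t)x_t+\alpha_t y_t,\qquad x_{t+1}\in\arg\min_x\tilde f_\eta(x;w_t),\qquad y_{t+1}\in\arg\min_x\phi_{t+1}(x),$$ $$\phi_{t+1}(x)=\phi_t(x)+\tfrac{\bar\mu_t-\bar\mu_{t-1}}{2}\|x-x_0\|^2+\tfrac{\alpha_t}{A_t}\big[f(x_{t+1})+\langle\nabla f(x_{t+1}),x-x_{t+1}\rangle\big].$$ The Hessian approximation $H_t$ used at $w_t$ satisfies $\frac{\mu_t}{2}I\preceq H_t-\nabla^2f(w_t)\preceq\mu_t I$ for some $0\le\mu_t\le\mu_u$, for every $t\ge0$ used. *Multi-stage AINCR.* For $s=1,2,\dots$ let $$T_s=2\max\Big\{\Big(\frac{196\gamma R_{s-1}}{\lambda}\Big)^{1/3},\,2\Big(\frac{6\mu_u}{\lambda}\Big)^{1/2}\Big\},$$ run AINCR with the convex parameters from $x_0=z_{s-1}$ for $\lceil T_s\rceil$ iterations, and set $z_s=x_{\lceil T_s\rceil}$. Then for all $s\ge0$ $$\|z_s-x_*\|^2\le\Big(\frac12\Big)^sR_0^2,\qquad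 f(z_s)-f(x_*)\le\Big(\frac14\Big)^s\,[f(z_0)-f(x_*)].$$ Moreover let $\Delta=f(z_0)-f(x_*)$ and $\epsilon>0$, and let $S$ be $\lceil\log_4(\Delta/\epsilon)\rceil$ if $\Delta>\epsilon$ and $S=0$ otherwise. Then $f(z_S)-f(x_*)\le\epsilon$ and $$\sum_{s=1}^ST_s\le 8\Big(\frac{392\gamma R_0}{\lambda}\Big)^{1/3}+4S\sqrt{\frac{6\mu_u}{\lambda}},\qquad \sum_{s=1}^S\lceil T_s\rceil\le 8\Big(\frac{392\gamma R_0}{\lambda}\Big)^{1/3}+4S\sqrt{\frac{6\mu_u}{\lambda}}+S.$$ Consequently, if $\epsilon\le\Delta/4$, then $$\sum_{s=1}^ST_s\le 60\Big[\sqrt{\frac{\mu_u}{\lambda}}\,\ln\frac{\Delta}{\epsilon}+\Big(\frac{\gamma R_0}{\lambda}\Big)^{1/3}\Big],\qquad \sum_{s=1}^S\lceil T_s\rceil\le 60\Big[\Big(\sqrt{\frac{\mu_u}{\lambda}}+1\Big)\ln\frac{\Delta}{\epsilon}+\Big(\frac{\gamma R_0}{\lambda}\Big)^{1/3}\Big].$$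 -/

import Mathlib

open scoped Gradient

noncomputable section

namespace AINCR

/-- The Euclidean space `ℝⁿ`. -/
abbrev E (n : ℕ) : Type := EuclideanSpace ℝ (Fin n)

/-- The Hessian `∇² f (x)`, as a linear operator: the derivative of the gradient field. -/
def hessian {n : ℕ} (f : E n → ℝ) (x : E n) : E n →L[ℝ] E n :=
  fderiv ℝ (fun y => ∇ f y) x

/-- The cubically regularized second-order model of `f` around `w`, with approximate Hessian `H`
and regularization parameter `η`. -/
def cubicModel {n : ℕ} (f : E n → ℝ) (H : E n →L[ℝ] E n) (η : ℝ) (w x : E n) : ℝ :=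
  f w + inner ℝ (∇ f w) (x - w) + 1 / 2 * inner ℝ (H (x - w)) (x - w) + η / 6 * ‖x - w‖ ^ 3

/-- The lower model `f(u) + ⟨∇f(u), x - u⟩ + (lam / 2) ‖x - u‖²` of `f` around `u`. -/
def lowerModel {n : ℕ} (f : E n → ℝ) (lam : ℝ) (x u : E n) : ℝ :=
  f u + inner ℝ (∇ f u) (x - u) + lam / 2 * ‖x - u‖ ^ 2

/-- `A_t = ∏_{i=1}^t (1 - α_i)`, with `A_0 = 1`. -/
def prodA (α : ℕ → ℝ) (t : ℕ) : ℝ := ∏ i ∈ Finset.Icc 1 t, (1 - α i)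

/-- Scalar parameters of the accelerated inexact Newton method with cubic regularization. -/
structure Params where
  /-- regularization parameter of the cubic subproblems -/
  η : ℝ
  /-- coefficient of the cubic term of the estimate functions -/
  β : ℝ
  /-- step sizes -/
  α : ℕ → ℝ
  /-- coefficients of the quadratic term of the estimate functions -/
  μbar : ℕ → ℝ
  /-- the (strong) convexity parameter that the method is given -/
  lam : ℝ

/-- The parameter choice for the convex case (the method is given convexity parameter `0`). -/
def convexParams (γ μu : ℝ) : Params where
  η := 4 * γ
  β := 96 * γ
  α := fun t => 3 / ((t : ℝ) + 3)
  μbar := fun t => 2 * μu * ((t : ℝ) + 2)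
  lam := 0

/-- `x, y, w, φ` are produced by `T` iterations of the accelerated inexact Newton method with
cubic regularization, started at `x₀`, with Hessian approximations `H`, i.e. the iterates
`x 1, …, x T` are computed as the method prescribes. (The entries `y 0` and `φ 0` are not used.) -/
structure IsRun {n : ℕ} (f : E n → ℝ) (γ : ℝ) (P : Params) (x₀ : E n) (T : ℕ)
    (H : ℕ → E n →L[ℝ] E n) (x y w : ℕ → E n) (φ : ℕ → E n → ℝ) : Prop where
  x_zero : x 0 = x₀
  w_zero : w 0 = x₀
  x_one : IsMinOn (cubicModel f (H 0) γ x₀) Set.univ (x 1)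
  φ_one : ∀ u, φ 1 u = f (x 1) + P.μbar 0 / 2 * ‖u - x₀‖ ^ 2 + P.β / 6 * ‖u - x₀‖ ^ 3
  y_one : IsMinOn (φ 1) Set.univ (y 1)
  w_eq : ∀ t, 1 ≤ t → t < T → w t = (1 - P.α t) • x t + P.α t • y t
  x_succ : ∀ t, 1 ≤ t → t < T → IsMinOn (cubicModel f (H t) P.η (w t)) Set.univ (x (t + 1))
  φ_succ : ∀ t, 1 ≤ t → t < T → ∀ u,
    φ (t + 1) u = φ t u + (P.μbar t - P.μbar (t - 1)) / 2 * ‖u - x₀‖ ^ 2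
      + P.α t / prodA P.α t * lowerModel f P.lam u (x (t + 1))
  y_succ : ∀ t, 1 ≤ t → t < T → IsMinOn (φ (t + 1)) Set.univ (y (t + 1))

/-- Accuracy of the Hessian approximations used in the first `T` iterations: for some
`0 ≤ μ_t ≤ μu` one has `(μ_t / 2) I ⪯ H_t - ∇² f (w_t) ⪯ μ_t I` in the Loewner order. -/
def HessianAccuracy {n : ℕ} (f : E n → ℝ) (μu : ℝ) (T : ℕ)
    (H : ℕ → E n →L[ℝ] E n) (w : ℕ → E n) : Prop :=
  ∃ μ : ℕ → ℝ, ∀ t < T, 0 ≤ μ t ∧ μ t ≤ μu ∧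
    (μ t / 2) • (1 : E n →L[ℝ] E n) ≤ H t - hessian f (w t) ∧
    H t - hessian f (w t) ≤ μ t • (1 : E n →L[ℝ] E n)

/-- `R_s = R₀ / 2^s`. -/
def radius (R₀ : ℝ) (s : ℕ) : ℝ := R₀ / 2 ^ s

/-- The prescribed length of stage `s ≥ 1`, a real number:
`T_s = 2 max {(196 γ R_{s-1} / lam)^{1/3}, 2 (6 μu / lam)^{1/2}}`. -/
def stageLength (γ lam μu R₀ : ℝ) (s : ℕ) : ℝ :=
  2 * max ((196 * γ * radius R₀ (s - 1) / lam) ^ (1 / 3 : ℝ)) (2 * √(6 * μu / lam))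

/-- The number of iterations carried out in stage `s ≥ 1`: the length `T_s` rounded up. -/
def stageIterations (γ lam μu R₀ : ℝ) (s : ℕ) : ℕ := ⌈stageLength γ lam μu R₀ s⌉₊

/-- `z` is generated by the multi-stage method: for `s ≥ 1`, `z s` is the last iterate of a run of
the method with the convex parameters, started at `z (s - 1)`, with sufficiently accurate
Hessian approximations. -/
def IsMultiStage {n : ℕ} (f : E n → ℝ) (γ lam μu R₀ : ℝ) (z : ℕ → E n) : Prop :=
  ∀ s, 1 ≤ s → ∃ (H : ℕ → E n →L[ℝ] E n) (x y w : ℕ → E n) (φ : ℕ → E n → ℝ),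
    IsRun f γ (convexParams γ μu) (z (s - 1)) (stageIterations γ lam μu R₀ s) H x y w φ ∧
    HessianAccuracy f μu (stageIterations γ lam μu R₀ s) H w ∧
    z s = x (stageIterations γ lam μu R₀ s)

/-- The number of stages `⌈log₄ (Δ / ε)⌉` (and `0` if this is negative) for initial gap `Δ`. -/
def numStages (Δ ε : ℝ) : ℕ := ⌈Real.logb 4 (Δ / ε)⌉₊

end AINCR

end

/-! A single run obeys an estimate-sequence argument. With `1/A_t = (t+1)(t+2)(t+3)/6`, the estimate
function satisfies `f(x_{t+1})/A_t ≤ φ_{t+1}(u)` (`IsRun.value_le_estimate`) and exceeds `f(u)/A_t`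
by at most `μu (t+5/2) ‖u-x₀‖² + (49/3) γ ‖u-x₀‖³` (`IsRun.estimate_le`). Dividing by `1/A_t` gives
the rate `6 μu D²/t² + 98 γ D³/t³` for an initial distance `D` (`IsRun.rate`).

The lower bound is the substantial half. The stationarity condition of the cubic step shows that the
new gradient is nearly a negative multiple of the step, so the decrease `⟨g, w - x₊⟩` pays for any
linear term `⟨g, u⟩` up to a quadratic and a cubic in `‖u‖` (`cubic_step_key`). Those two terms are
absorbed by the uniform convexity of `φ` around its minimizer (`IsRun.estimate_growth`).

The stage length makes each term of the rate at most `λ D²/16`, so a stage ends with gap at most `λ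
D²/8` (`stage_gap_le`). Since `λ D²/2` is at most the gap (`quadratic_growth`), the distance halves
and the gap quarters. The cubic parts of the stage lengths then form a geometric series of ratio
`2^(-1/3)`, while the quadratic parts are constant. -/

namespace AINCR

/-! ### Cubed norms and Loewner bounds in inner product spaces. -/

section InnerProductGeometry

variable {V : Type*} [NormedAddCommGroup V] [InnerProductSpace ℝ V]

/-- Uniform convexity of degree three of the cubed norm. -/
lemma norm_cube_uniform_convexity (a b : V) :
    ‖b‖ ^ 3 + 3 * ‖b‖ * inner ℝ b (a - b) + 1 / 2 * ‖a - b‖ ^ 3 ≤ ‖a‖ ^ 3 := by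
  have h1 : ‖a‖ ^ 2 = ‖b‖ ^ 2 + 2 * inner ℝ b (a - b) + ‖a - b‖ ^ 2 := by
    have := norm_add_sq_real b (a - b)
    rwa [add_sub_cancel] at this
  have h2 : ‖a - b‖ ≤ ‖a‖ + ‖b‖ := norm_sub_le a b
  have hA := norm_nonneg a
  have hB := norm_nonneg b
  have hD := norm_nonneg (a - b)
  generalize ‖a‖ = A at *
  generalize ‖b‖ = B at *
  generalize ‖a - b‖ = D at *
  have h3 : inner ℝ b (a - b) = (A ^ 2 - B ^ 2 - D ^ 2) / 2 := by linarith
  rw [h3]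
  -- Uses `A³ - (3/2) A² B + B³/2 = (A - B)² (A + B/2)`. For `D ≤ 3B` the last term alone suffices;
  -- for `D ≥ 3B` the triangle inequality forces `A - B ≥ D - 2B ≥ 0`.
  suffices h : 1 / 2 * D ^ 3 ≤ (A - B) ^ 2 * (A + B / 2) + 3 / 2 * B * D ^ 2 by nlinarith
  rcases le_total D (3 * B) with h | h
  · have : 0 ≤ (A - B) ^ 2 * (A + B / 2) := by positivity
    nlinarith [mul_nonneg (sub_nonneg.2 h) (sq_nonneg D)]
  · have h4 : (D - 2 * B) ^ 2 * (D - B / 2) ≤ (A - B) ^ 2 * (A + B / 2) := by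
      have h5 : (D - 2 * B) ^ 2 ≤ (A - B) ^ 2 :=
        pow_le_pow_left₀ (by linarith) (by linarith) 2
      exact mul_le_mul h5 (by linarith) (by linarith) (sq_nonneg _)
    have h6 : 0 ≤ 1 / 2 * D ^ 3 - 3 * B * D ^ 2 + 6 * B ^ 2 * D - 2 * B ^ 3 := by
      nlinarith [mul_nonneg hB (sq_nonneg (D - 3 * B)), mul_nonneg hD (sq_nonneg (D - 3 * B)),
        mul_nonneg (mul_nonneg hB hB) (sub_nonneg.2 h),
        mul_nonneg (sub_nonneg.2 h) (sq_nonneg (D - 3 * B)),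
        mul_nonneg (sub_nonneg.2 h) (sq_nonneg (2 * D - 7 * B)),
        mul_nonneg hB (sq_nonneg (2 * D - 7 * B)), pow_nonneg hB 3]
    nlinarith

lemma hasDerivAt_norm_cube_line (h d : V) :
    HasDerivAt (fun s : ℝ => ‖h + s • d‖ ^ 3) (3 * ‖h‖ * inner ℝ h d) 0 := by
  have h1 := hasFDerivAt_norm_rpow (h + (0 : ℝ) • d) (p := 3) (by norm_num)
  have h2 : HasDerivAt (fun s : ℝ => h + s • d) d 0 := by
    simpa using ((hasDerivAt_id (0 : ℝ)).smul_const d).const_add h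
  have h3 := h1.comp_hasDerivAt (0 : ℝ) h2
  have h4 : ((3 : ℝ) - 2) = 1 := by norm_num
  simp only [zero_smul, add_zero, h4, Real.rpow_one] at h3
  refine (h3.congr_deriv ?_).congr_of_eventuallyEq (Filter.Eventually.of_forall fun s => ?_)
  · simp
  · simp only [Function.comp]
    norm_cast

/-- First-order optimality for a cubically regularized quadratic with symmetric quadratic part. -/
lemma stationary_of_isMin_cubic (l : V) (Q : V →L[ℝ] V)
    (hQ : ∀ u v, inner ℝ (Q u) v = inner ℝ u (Q v)) (k : ℝ) (h : V)
    (hmin : ∀ u, inner ℝ l h + 1 / 2 * inner ℝ (Q h) h + k * ‖h‖ ^ 3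
      ≤ inner ℝ l u + 1 / 2 * inner ℝ (Q u) u + k * ‖u‖ ^ 3) :
    l + Q h + (3 * k * ‖h‖) • h = 0 := by
  refine ext_inner_right ℝ fun d => ?_
  have e : ∀ s : ℝ, inner ℝ l (h + s • d) + 1 / 2 * inner ℝ (Q (h + s • d)) (h + s • d)
      + k * ‖h + s • d‖ ^ 3 = (inner ℝ l h + 1 / 2 * inner ℝ (Q h) h)
      + s * (inner ℝ l d + inner ℝ (Q h) d) + s ^ 2 * (1 / 2 * inner ℝ (Q d) d)
      + k * ‖h + s • d‖ ^ 3 := fun s => by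
    have : inner ℝ (Q d) h = inner ℝ (Q h) d := by rw [hQ, real_inner_comm]
    simp only [map_add, map_smul, inner_add_left, inner_add_right, inner_smul_left,
      inner_smul_right, this, RCLike.conj_to_real]
    ring
  have hd : HasDerivAt (fun s : ℝ => inner ℝ l (h + s • d)
      + 1 / 2 * inner ℝ (Q (h + s • d)) (h + s • d) + k * ‖h + s • d‖ ^ 3)
      (inner ℝ l d + inner ℝ (Q h) d + k * (3 * ‖h‖ * inner ℝ h d)) 0 := by
    simp only [e]
    have h1 := (((hasDerivAt_id (0 : ℝ)).mul_const (inner ℝ l d + inner ℝ (Q h) d)).const_add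
      (inner ℝ l h + 1 / 2 * inner ℝ (Q h) h)).add
      (((hasDerivAt_id (0 : ℝ)).pow 2).mul_const (1 / 2 * inner ℝ (Q d) d))
    refine ((h1.add ((hasDerivAt_norm_cube_line h d).const_mul k))).congr_deriv ?_
    simp
  have hm : IsLocalMin (fun s : ℝ => inner ℝ l (h + s • d)
      + 1 / 2 * inner ℝ (Q (h + s • d)) (h + s • d) + k * ‖h + s • d‖ ^ 3) 0 :=
    Filter.Eventually.of_forall fun s => by simpa using hmin (h + s • d)
  have := hm.hasDerivAt_eq_zero hd
  simp only [inner_add_left, inner_smul_left, inner_zero_left, RCLike.conj_to_real]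
  linarith

/-- If `m I ⪯ B ⪯ M I` then `B - (m + M) / 2 I` has norm at most `(M - m) / 2`. -/
lemma norm_sub_mid_le_of_loewner (B : V →L[ℝ] V) (m M : ℝ) (hm : m ≤ M)
    (h₁ : m • (1 : V →L[ℝ] V) ≤ B) (h₂ : B ≤ M • (1 : V →L[ℝ] V)) (h : V) :
    ‖B h - ((m + M) / 2) • h‖ ≤ (M - m) / 2 * ‖h‖ := by
  have hP := (ContinuousLinearMap.le_def _ _).1 h₁
  have hQ := (ContinuousLinearMap.le_def _ _).1 h₂
  set P := B - m • (1 : V →L[ℝ] V) with hPdef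
  have hBP : ∀ u, B u = P u + m • u := fun u => by simp [hPdef]
  have hPn : ∀ u, 0 ≤ inner ℝ (P u) u := fun u => hP.inner_nonneg_left u
  have hPs : ∀ u v, inner ℝ (P u) v = inner ℝ u (P v) := fun u v => hP.isSymmetric u v
  have hPk : ∀ u, inner ℝ (P u) u ≤ (M - m) * ‖u‖ ^ 2 := fun u => by
    have := hQ.inner_nonneg_left u
    simp [hBP, inner_sub_left, inner_add_left, inner_smul_left] at this
    rw [← real_inner_self_eq_norm_sq]; simp; linarith
  -- For `0 ⪯ P ⪯ k I` with `k > 0`, test `P ⪰ 0` on `k h - P h` and bound `⟨P(P h), P h⟩` by `k ‖P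
  -- h‖²`. If `k = 0`, the vector `h - P h` does the job. Expanding `‖P h - (k/2) h‖²` then leaves
  -- at most `(k/2)² ‖h‖²`.
  have key : ‖P h‖ ^ 2 ≤ (M - m) * inner ℝ (P h) h := by
    rcases hm.eq_or_lt with rfl | hlt
    · have h1 := hPn (h - P h)
      have h2 := hPk h
      have h3 := hPk (P h)
      have h4 : inner ℝ (P (P h)) h = ‖P h‖ ^ 2 := by rw [hPs, real_inner_self_eq_norm_sq]
      simp only [map_sub, inner_sub_left, inner_sub_right, h4, real_inner_self_eq_norm_sq,
        sub_self, zero_mul] at *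
      nlinarith [sq_nonneg ‖P h‖]
    · have h1 := hPn ((M - m) • h - P h)
      have h3 := hPk (P h)
      have h4 : inner ℝ (P (P h)) h = ‖P h‖ ^ 2 := by rw [hPs, real_inner_self_eq_norm_sq]
      simp only [map_sub, map_smul, inner_sub_left, inner_sub_right, h4, inner_smul_left,
        inner_smul_right, real_inner_self_eq_norm_sq, RCLike.conj_to_real] at *
      have : 0 ≤ (M - m) * ((M - m) * inner ℝ (P h) h - ‖P h‖ ^ 2) := by nlinarith
      have := nonneg_of_mul_nonneg_right this (sub_pos.2 hlt)
      linarith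
  refine le_of_sq_le_sq ?_ (by have := norm_nonneg h; nlinarith)
  have e : B h - ((m + M) / 2) • h = P h - ((M - m) / 2) • h := by
    rw [hBP]; module
  rw [e, norm_sub_sq_real, inner_smul_right, norm_smul, mul_pow, mul_pow, Real.norm_eq_abs, sq_abs]
  nlinarith

end InnerProductGeometry

/-! ### Taylor estimates, convexity and quadratic growth. -/

section Calculus

variable {n : ℕ} {f : E n → ℝ}

lemma hasDerivAt_line (hf : ContDiff ℝ 2 f) (x d : E n) (s : ℝ) :
    HasDerivAt (fun s : ℝ => f (x + s • d)) (inner ℝ (∇ f (x + s • d)) d) s := by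
  have h1 : DifferentiableAt ℝ f (x + s • d) := hf.differentiable (by norm_num) _
  have h2 : HasDerivAt (fun s : ℝ => x + s • d) d s := by
    simpa using ((hasDerivAt_id s).smul_const d).const_add x
  have := h1.hasGradientAt.hasFDerivAt.comp_hasDerivAt s h2
  simpa [Function.comp_def] using this

lemma hasFDerivAt_gradient (hf : ContDiff ℝ 2 f) (x : E n) :
    HasFDerivAt (fun y => ∇ f y) (hessian f x) x := by
  have h1 : ContDiff ℝ 1 (fderiv ℝ f) := hf.fderiv_right (by norm_num)
  have h2 : Differentiable ℝ (fderiv ℝ f) := h1.differentiable (by norm_num)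
  have h3 : DifferentiableAt ℝ (fun y => ∇ f y) x := by
    simp only [gradient]
    exact ((InnerProductSpace.toDual ℝ (E n)).symm.toContinuousLinearEquiv.differentiableAt).comp x
      (h2 x)
  exact h3.hasFDerivAt

lemma inner_hessian_eq (hf : ContDiff ℝ 2 f) (x u v : E n) :
    inner ℝ (hessian f x u) v = fderiv ℝ (fderiv ℝ f) x u v := by
  have h1 : ContDiff ℝ 1 (fderiv ℝ f) := hf.fderiv_right (by norm_num)
  have h2 : HasFDerivAt (fderiv ℝ f) (fderiv ℝ (fderiv ℝ f) x) x :=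
    (h1.differentiable (by norm_num) x).hasFDerivAt
  have h3 := (hasFDerivAt_gradient hf x).inner ℝ (hasFDerivAt_const v x)
  have h4 : (fun y => inner ℝ (∇ f y) v) = fun y => fderiv ℝ f y v := by
    funext y; simp [gradient]
  have h5 := h2.clm_apply (hasFDerivAt_const v x)
  rw [h4] at h3
  have := congrArg (fun L => L u) (h3.unique h5)
  simpa using this

lemma hessian_symmetric (hf : ContDiff ℝ 2 f) (x u v : E n) :
    inner ℝ (hessian f x u) v = inner ℝ u (hessian f x v) := by
  rw [inner_hessian_eq hf, real_inner_comm, inner_hessian_eq hf]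
  exact (hf.contDiffAt.isSymmSndFDerivAt (by simp)) u v

/-- The parameter `s` is kept because this estimate serves as the derivative bound along the segment
when `abs_taylor_le` integrates once more. -/
lemma norm_gradient_taylor_le (hf : ContDiff ℝ 2 f) {γ : ℝ}
    (hLip : ∀ x x' : E n, ‖hessian f x - hessian f x'‖ ≤ γ * ‖x - x'‖) (x d : E n)
    {s : ℝ} (hs : 0 ≤ s) :
    ‖∇ f (x + s • d) - ∇ f x - s • hessian f x d‖ ≤ γ / 2 * ‖d‖ ^ 2 * s ^ 2 := by
  have hd : ∀ s : ℝ, HasDerivAt (fun s : ℝ => ∇ f (x + s • d) - ∇ f x - s • hessian f x d)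
      (hessian f (x + s • d) d - hessian f x d) s := fun s => by
    have h2 : HasDerivAt (fun s : ℝ => x + s • d) d s := by
      simpa using ((hasDerivAt_id s).smul_const d).const_add x
    have h3 := (hasFDerivAt_gradient hf (x + s • d)).comp_hasDerivAt s h2
    have h4 := (h3.sub_const (∇ f x)).sub ((hasDerivAt_id s).smul_const (hessian f x d))
    exact h4.congr_deriv (by simp)
  have hB : ∀ s : ℝ, HasDerivAt (fun s : ℝ => γ / 2 * ‖d‖ ^ 2 * s ^ 2) (γ * ‖d‖ ^ 2 * s) s :=
    fun s => by
      refine ((hasDerivAt_pow 2 s).const_mul (γ / 2 * ‖d‖ ^ 2)).congr_deriv ?_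
      push_cast; ring
  refine image_norm_le_of_norm_deriv_right_le_deriv_boundary (a := 0) (b := s)
    (fun y _ => (hd y).continuousAt.continuousWithinAt) (fun y _ => (hd y).hasDerivWithinAt)
    (by simp) hB (fun y hy => ?_) ⟨hs, le_rfl⟩
  rw [← _root_.sub_apply]
  refine (ContinuousLinearMap.le_opNorm _ _).trans ?_
  have h1 := hLip (x + y • d) x
  rw [add_sub_cancel_left, norm_smul, Real.norm_eq_abs, abs_of_nonneg hy.1] at h1
  nlinarith [norm_nonneg d, mul_le_mul_of_nonneg_right h1 (norm_nonneg d)]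

lemma norm_gradient_sub_le (hf : ContDiff ℝ 2 f) {γ : ℝ}
    (hLip : ∀ x x' : E n, ‖hessian f x - hessian f x'‖ ≤ γ * ‖x - x'‖) (x y : E n) :
    ‖∇ f y - ∇ f x - hessian f x (y - x)‖ ≤ γ / 2 * ‖y - x‖ ^ 2 := by
  simpa using norm_gradient_taylor_le hf hLip x (y - x) zero_le_one

lemma abs_taylor_le (hf : ContDiff ℝ 2 f) {γ : ℝ}
    (hLip : ∀ x x' : E n, ‖hessian f x - hessian f x'‖ ≤ γ * ‖x - x'‖) (x y : E n) :
    |f y - f x - inner ℝ (∇ f x) (y - x) - 1 / 2 * inner ℝ (hessian f x (y - x)) (y - x)|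
      ≤ γ / 6 * ‖y - x‖ ^ 3 := by
  set d := y - x with hd'
  have hd : ∀ s : ℝ, HasDerivAt (fun s : ℝ => f (x + s • d) - f x - s * inner ℝ (∇ f x) d
      - s ^ 2 * (1 / 2 * inner ℝ (hessian f x d) d))
      (inner ℝ (∇ f (x + s • d) - ∇ f x - s • hessian f x d) d) s := fun s => by
    have h4 := (((hasDerivAt_line hf x d s).sub_const (f x)).sub
      ((hasDerivAt_id s).mul_const (inner ℝ (∇ f x) d))).sub
      ((hasDerivAt_pow 2 s).mul_const (1 / 2 * inner ℝ (hessian f x d) d))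
    refine h4.congr_deriv ?_
    simp only [inner_sub_left, inner_smul_left, RCLike.conj_to_real]
    push_cast; ring
  have hB : ∀ s : ℝ, HasDerivAt (fun s : ℝ => γ / 6 * ‖d‖ ^ 3 * s ^ 3)
      (γ / 2 * ‖d‖ ^ 2 * s ^ 2 * ‖d‖) s := fun s => by
    refine ((hasDerivAt_pow 3 s).const_mul (γ / 6 * ‖d‖ ^ 3)).congr_deriv ?_
    push_cast; ring
  have := image_norm_le_of_norm_deriv_right_le_deriv_boundary (a := 0) (b := 1)
    (fun y _ => (hd y).continuousAt.continuousWithinAt) (fun y _ => (hd y).hasDerivWithinAt)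
    (by simp) hB (fun y hy => (norm_inner_le_norm _ _).trans
      (mul_le_mul_of_nonneg_right (norm_gradient_taylor_le hf hLip x d hy.1) (norm_nonneg d)))
    ⟨zero_le_one, le_rfl⟩
  simpa [hd'] using this

lemma gradient_inequality (hf : ContDiff ℝ 2 f) (hc : ConvexOn ℝ Set.univ f) (u x : E n) :
    f u + inner ℝ (∇ f u) (x - u) ≤ f x := by
  have h1 : ConvexOn ℝ Set.univ (fun s : ℝ => f (u + s • (x - u))) := by
    have := hc.comp_affineMap (AffineMap.lineMap (k := ℝ) u x)
    refine this.congr fun s _ => ?_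
    simp [AffineMap.lineMap_apply, add_comm]
  have h2 := hasDerivAt_line hf u (x - u) 0
  have h3 := h1.le_slope_of_hasDerivAt (Set.mem_univ 0) (Set.mem_univ 1) zero_lt_one h2
  simp only [zero_smul, add_zero, slope_def_field, one_smul, add_sub_cancel, sub_zero,
    div_one] at h3
  linarith

/-- Compare `f xs` with the value at `a x + (1-a) xs`, divide the strong convexity inequality by
`a`, and let `a → 0⁺`. -/
lemma quadratic_growth {lam : ℝ} (hc : StrongConvexOn Set.univ lam f) {xs : E n}
    (hxs : IsMinOn f Set.univ xs) (x : E n) :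
    lam / 2 * ‖x - xs‖ ^ 2 ≤ f x - f xs := by
  have key : ∀ a : ℝ, 0 < a → a < 1 → (1 - a) * (lam / 2 * ‖x - xs‖ ^ 2) ≤ f x - f xs := by
    intro a ha ha1
    have h1 := hc.2 (Set.mem_univ x) (Set.mem_univ xs) ha.le (sub_nonneg.2 ha1.le) (by ring)
    have h2 : f xs ≤ f (a • x + (1 - a) • xs) := hxs (Set.mem_univ _)
    simp only [smul_eq_mul] at h1
    have : 0 ≤ a * ((f x - f xs) - (1 - a) * (lam / 2 * ‖x - xs‖ ^ 2)) := by nlinarith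
    linarith [nonneg_of_mul_nonneg_right this ha]
  have hlim : Filter.Tendsto (fun a : ℝ => (1 - a) * (lam / 2 * ‖x - xs‖ ^ 2))
      (nhdsWithin 0 (Set.Ioi 0)) (nhds (lam / 2 * ‖x - xs‖ ^ 2)) := by
    have : Continuous fun a : ℝ => (1 - a) * (lam / 2 * ‖x - xs‖ ^ 2) := by fun_prop
    simpa using (this.tendsto 0).mono_left nhdsWithin_le_nhds
  refine le_of_tendsto hlim ?_
  filter_upwards [Ioo_mem_nhdsGT (zero_lt_one' ℝ)] with a ha
  exact key a ha.1 ha.2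

end Calculus

/-! ### The cubically regularized Newton step. -/

section NewtonStep

/-- The scalar inequality behind the acceleration step. Here `G` is the norm of the gradient at the
new iterate, `r` the length of the step and `D` the decrease `⟨g, w - x₊⟩`. -/
lemma gradient_mul_le_of_step {G p r μ γ D : ℝ} (hp : 0 ≤ p) (hr : 0 ≤ r)
    (hμ : 0 ≤ μ) (hγ : 0 < γ) (h0 : r = 0 → G = 0 ∧ D = 0)
    (hD : G ^ 2 - 2 * (3 / 4 * μ + 2 * γ * r) * D + (3 / 4 * μ + 2 * γ * r) ^ 2 * r ^ 2
      ≤ (μ / 4 + γ * r / 2) ^ 2 * r ^ 2) :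
    G * p ≤ D + 2 / 3 * μ * p ^ 2 + 16 / 9 * γ * p ^ 3 := by
  rcases hr.eq_or_lt with hr0 | hr
  · obtain ⟨hG, hD0⟩ := h0 hr0.symm
    rw [hG, hD0]
    have : 0 ≤ μ * p ^ 2 := by positivity
    have : 0 ≤ γ * p ^ 3 := by positivity
    linarith
  set a := 3 / 4 * μ + 2 * γ * r with ha
  have hγr : 0 < γ * r := by positivity
  have hapos : 0 < a := by nlinarith
  -- The error is at most a third of the multiplier `a`; this leaves the surplus `(8/9) a² r²`,
  -- which later cancels the mixed term `γ r p²`.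
  have hb : (μ / 4 + γ * r / 2) ^ 2 ≤ a ^ 2 / 9 := by
    have : μ / 4 + γ * r / 2 ≤ a / 3 := by rw [ha]; nlinarith
    calc _ ≤ (a / 3) ^ 2 := pow_le_pow_left₀ (by positivity) this 2
      _ = _ := by ring
  have h1 : G ^ 2 + 8 / 9 * a ^ 2 * r ^ 2 ≤ 2 * a * D := by
    nlinarith [mul_le_mul_of_nonneg_right hb (sq_nonneg r)]
  have h2 : 2 * a * (G * p) ≤ G ^ 2 + a ^ 2 * p ^ 2 := by nlinarith [sq_nonneg (G - a * p)]
  have h3 : a * (2 * (G * p)) ≤ a * (2 * D - 8 / 9 * a * r ^ 2 + a * p ^ 2) := by nlinarith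
  have h4 := le_of_mul_le_mul_left h3 hapos
  have h5 : γ * r * p ^ 2 ≤ 8 / 9 * (γ * r) * r ^ 2 + 16 / 9 * γ * p ^ 3 := by
    have h : r * p ^ 2 ≤ 8 / 9 * r ^ 3 + 16 / 9 * p ^ 3 := by
      rcases le_total r (16 / 9 * p) with h | h
      · have := mul_le_mul_of_nonneg_right h (sq_nonneg p)
        have : 0 ≤ r ^ 3 := by positivity
        nlinarith
      · have h6 : p ^ 2 ≤ (9 / 16 * r) ^ 2 := pow_le_pow_left₀ hp (by linarith) 2
        have := mul_le_mul_of_nonneg_left h6 hr.le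
        have : 0 ≤ p ^ 3 := by positivity
        have : 0 ≤ r ^ 3 := by positivity
        nlinarith
    nlinarith
  have h6 : 2 * (γ * r) * r ^ 2 ≤ a * r ^ 2 :=
    mul_le_mul_of_nonneg_right (by rw [ha]; nlinarith) (sq_nonneg r)
  have h7 : a * p ^ 2 = 3 / 4 * μ * p ^ 2 + 2 * (γ * r * p ^ 2) := by rw [ha]; ring
  have : 0 ≤ μ * p ^ 2 := by positivity
  linarith

variable {n : ℕ} {f : E n → ℝ} {γ μ : ℝ} {H : E n →L[ℝ] E n} {w : E n}

/-- The Loewner order includes symmetry of the difference, so `H` inherits it from the true Hessian.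
-/
lemma approx_hessian_symmetric (hf : ContDiff ℝ 2 f)
    (hH : H - hessian f w ≤ μ • (1 : E n →L[ℝ] E n)) (u v : E n) :
    inner ℝ (H u) v = inner ℝ u (H v) := by
  have h1 := ((ContinuousLinearMap.le_def _ _).1 hH).isSymmetric u v
  have h2 := hessian_symmetric hf w u v
  simp [inner_sub_left, inner_sub_right, inner_smul_left, inner_smul_right] at h1
  linarith

lemma cubicModel_stationary (hf : ContDiff ℝ 2 f) (η : ℝ)
    (hH : H - hessian f w ≤ μ • (1 : E n →L[ℝ] E n)) {x : E n}
    (hx : IsMinOn (cubicModel f H η w) Set.univ x) :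
    ∇ f w + H (x - w) + (η / 2 * ‖x - w‖) • (x - w) = 0 := by
  have := stationary_of_isMin_cubic (∇ f w) H (approx_hessian_symmetric hf hH) (η / 6) (x - w)
    fun u => by
      have h : cubicModel f H η w x ≤ cubicModel f H η w (w + u) := hx (Set.mem_univ _)
      simp only [cubicModel, add_sub_cancel_left] at h
      linarith
  rw [← this]
  congr 3
  ring

/-- The key inequality of the accelerated method: the decrease produced by the cubic step
compensates the linear term of the estimate function. -/
lemma cubic_step_key (hf : ContDiff ℝ 2 f) (hγ : 0 < γ)
    (hLip : ∀ x x' : E n, ‖hessian f x - hessian f x'‖ ≤ γ * ‖x - x'‖)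
    (hμ : 0 ≤ μ) (h₁ : (μ / 2) • (1 : E n →L[ℝ] E n) ≤ H - hessian f w)
    (h₂ : H - hessian f w ≤ μ • (1 : E n →L[ℝ] E n)) {x : E n}
    (hx : IsMinOn (cubicModel f H (4 * γ) w) Set.univ x) (u : E n) :
    0 ≤ inner ℝ (∇ f x) (w - x) + inner ℝ (∇ f x) u
      + 2 / 3 * μ * ‖u‖ ^ 2 + 16 / 9 * γ * ‖u‖ ^ 3 := by
  have hs := cubicModel_stationary hf (4 * γ) h₂ hx
  have ht := norm_gradient_sub_le hf hLip w x
  have hB := norm_sub_mid_le_of_loewner (H - hessian f w) (μ / 2) μ (by linarith) h₁ h₂ (x - w)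
  set g := ∇ f x
  obtain ⟨h, hh⟩ : ∃ h, h = x - w := ⟨_, rfl⟩
  have hwx : w - x = -h := by rw [hh]; abel
  rw [← hh] at hs ht hB
  rw [hwx, inner_neg_right]
  set r := ‖h‖ with hr
  -- Stationarity eliminates `∇ f w`. Centring `H - ∇²f` at the midpoint `3μ/4` of its Loewner
  -- interval leaves an error `μ r/4`, besides the Taylor error `γ r²/2`.
  have e : g + (3 / 4 * μ + 2 * γ * r) • h = (g - ∇ f w - hessian f w h)
      - ((H - hessian f w) h - ((μ / 2 + μ) / 2) • h) := by
    have : ∇ f w = -(H h + (4 * γ / 2 * r) • h) := by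
      rw [eq_neg_iff_add_eq_zero, ← add_assoc]; exact hs
    rw [this, _root_.sub_apply]
    module
  have hn : ‖g + (3 / 4 * μ + 2 * γ * r) • h‖ ≤ (μ / 4 + γ * r / 2) * r := by
    rw [e]
    refine (norm_sub_le _ _).trans ?_
    linarith
  have hD := pow_le_pow_left₀ (norm_nonneg _) hn 2
  rw [norm_add_sq_real, inner_smul_right, norm_smul, mul_pow, Real.norm_eq_abs, sq_abs, ← hr,
    mul_pow] at hD
  have hmul := gradient_mul_le_of_step (G := ‖g‖) (p := ‖u‖) (r := r) (μ := μ) (γ := γ)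
    (D := -inner ℝ g h) (norm_nonneg u) (norm_nonneg h) hμ hγ
    (fun h0 => by
      have : h = 0 := norm_eq_zero.1 h0
      rw [h0, this] at hn
      simp only [smul_zero, add_zero, mul_zero] at hn
      exact ⟨le_antisymm hn (norm_nonneg _), by simp [this]⟩) (by linarith)
  have := neg_le_of_abs_le (abs_real_inner_le_norm g u)
  linarith

/-- With `cubicModel_le`, this handles the initial step, whose regularization is `γ` rather than
`4γ`. -/
lemma le_cubicModel (hf : ContDiff ℝ 2 f)
    (hLip : ∀ x x' : E n, ‖hessian f x - hessian f x'‖ ≤ γ * ‖x - x'‖)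
    (hμ : 0 ≤ μ) (h₁ : (μ / 2) • (1 : E n →L[ℝ] E n) ≤ H - hessian f w) (x : E n) :
    f x ≤ cubicModel f H γ w x := by
  have ht := (abs_le.1 (abs_taylor_le hf hLip w x)).2
  have h := ((ContinuousLinearMap.le_def _ _).1 h₁).inner_nonneg_left (x - w)
  simp only [cubicModel]
  generalize x - w = d at *
  simp only [_root_.sub_apply, _root_.smul_apply, one_apply_eq_self,
    inner_sub_left, inner_smul_left, real_inner_self_eq_norm_sq, RCLike.conj_to_real] at h
  have : 0 ≤ μ * ‖d‖ ^ 2 := by positivity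
  linarith

lemma cubicModel_le (hf : ContDiff ℝ 2 f)
    (hLip : ∀ x x' : E n, ‖hessian f x - hessian f x'‖ ≤ γ * ‖x - x'‖)
    (h₂ : H - hessian f w ≤ μ • (1 : E n →L[ℝ] E n)) (x : E n) :
    cubicModel f H γ w x ≤ f x + μ / 2 * ‖x - w‖ ^ 2 + γ / 3 * ‖x - w‖ ^ 3 := by
  have ht := (abs_le.1 (abs_taylor_le hf hLip w x)).1
  have h := ((ContinuousLinearMap.le_def _ _).1 h₂).inner_nonneg_left (x - w)
  simp only [cubicModel]
  generalize x - w = d at *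
  simp only [_root_.sub_apply, _root_.smul_apply, one_apply_eq_self,
    inner_sub_left, inner_smul_left, real_inner_self_eq_norm_sq, RCLike.conj_to_real] at h
  linarith

end NewtonStep

/-! ### Estimate functions and the rate of a single run. -/

section EstimateFunctions

/-- The product telescopes, since `1 - α_i = i/(i+3)`. -/
lemma prodA_convexParams (γ μu : ℝ) (t : ℕ) :
    prodA (convexParams γ μu).α t = 6 / (((t : ℝ) + 1) * (t + 2) * (t + 3)) := by
  induction t with
  | zero => norm_num [prodA]
  | succ t ih =>
    have : prodA (convexParams γ μu).α (t + 1)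
        = prodA (convexParams γ μu).α t * (1 - (convexParams γ μu).α (t + 1)) := by
      simp only [prodA]
      rw [Finset.prod_Icc_succ_top (by omega)]
    rw [this, ih]
    simp only [convexParams]
    push_cast
    field_simp
    ring

variable {n : ℕ} {f : E n → ℝ} {γ μu : ℝ} {x₀ : E n} {T : ℕ} {H : ℕ → E n →L[ℝ] E n}
  {x y w : ℕ → E n} {φ : ℕ → E n → ℝ}

lemma IsRun.estimate_one (hrun : IsRun f γ (convexParams γ μu) x₀ T H x y w φ) (u : E n) :
    φ 1 u = f (x 1) + 2 * μu * ‖u - x₀‖ ^ 2 + 16 * γ * ‖u - x₀‖ ^ 3 := by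
  rw [hrun.φ_one]
  simp only [convexParams]
  push_cast
  ring

lemma IsRun.estimate_succ (hrun : IsRun f γ (convexParams γ μu) x₀ T H x y w φ) {t : ℕ}
    (ht : t + 1 < T) (u : E n) :
    φ (t + 2) u = φ (t + 1) u + μu * ‖u - x₀‖ ^ 2
      + ((t : ℝ) + 2) * (t + 3) / 2
        * (f (x (t + 2)) + inner ℝ (∇ f (x (t + 2))) (u - x (t + 2))) := by
  rw [hrun.φ_succ (t + 1) (by omega) ht, prodA_convexParams]
  have h : (convexParams γ μu).α (t + 1) / (6 / ((((t + 1 : ℕ) : ℝ) + 1) * ((t + 1 : ℕ) + 2)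
      * ((t + 1 : ℕ) + 3))) = ((t : ℝ) + 2) * (t + 3) / 2 := by
    simp only [convexParams]
    push_cast
    field_simp
    ring
  rw [h]
  simp only [convexParams, lowerModel, add_tsub_cancel_right]
  push_cast
  ring

lemma IsRun.estimate_form (hrun : IsRun f γ (convexParams γ μu) x₀ T H x y w φ) (t : ℕ)
    (ht : t < T) : ∃ (c : ℝ) (l : E n), ∀ u, φ (t + 1) u
      = c + inner ℝ l (u - x₀) + μu * (t + 2) * ‖u - x₀‖ ^ 2 + 16 * γ * ‖u - x₀‖ ^ 3 := by
  induction t with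
  | zero =>
    refine ⟨f (x 1), 0, fun u => ?_⟩
    rw [zero_add, hrun.estimate_one, inner_zero_left]
    push_cast
    ring
  | succ t ih =>
    obtain ⟨c, l, h⟩ := ih (by omega)
    set g := ∇ f (x (t + 2)) with hg
    refine ⟨c + ((t : ℝ) + 2) * (t + 3) / 2 * (f (x (t + 2)) + inner ℝ g (x₀ - x (t + 2))),
      l + (((t : ℝ) + 2) * (t + 3) / 2) • g, fun u => ?_⟩
    have e : inner ℝ g (u - x (t + 2)) = inner ℝ g (x₀ - x (t + 2)) + inner ℝ g (u - x₀) := by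
      rw [← inner_add_right]; congr 1; abel
    rw [hrun.estimate_succ ht, h u, ← hg, e, inner_add_left, inner_smul_left,
      RCLike.conj_to_real]
    push_cast
    ring

/-- Uniform convexity of the estimate functions around their minimizers. -/
lemma IsRun.estimate_growth (hrun : IsRun f γ (convexParams γ μu) x₀ T H x y w φ) (hγ : 0 < γ)
    (t : ℕ) (ht : t < T) (u : E n) :
    φ (t + 1) (y (t + 1)) + μu * (t + 2) * ‖u - y (t + 1)‖ ^ 2 + 8 * γ * ‖u - y (t + 1)‖ ^ 3
      ≤ φ (t + 1) u := by
  obtain ⟨c, l, h⟩ := hrun.estimate_form t ht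
  have hy : IsMinOn (φ (t + 1)) Set.univ (y (t + 1)) := by
    rcases t with _ | t
    · exact hrun.y_one
    · exact hrun.y_succ (t + 1) (by omega) ht
  set m : ℝ := μu * (t + 2) with hm
  set b := y (t + 1) - x₀ with hb
  set a := u - x₀ with ha
  have hab : u - y (t + 1) = a - b := by rw [ha, hb]; abel
  have hst := stationary_of_isMin_cubic l ((2 * m) • (1 : E n →L[ℝ] E n))
    (fun u v => by simp [inner_smul_left, inner_smul_right]) (16 * γ) b fun v => by
      have h1 : φ (t + 1) (y (t + 1)) ≤ φ (t + 1) (x₀ + v) := hy (Set.mem_univ _)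
      rw [h, h, add_sub_cancel_left, ← hb] at h1
      simp only [_root_.smul_apply, one_apply_eq_self, inner_smul_left,
        real_inner_self_eq_norm_sq, RCLike.conj_to_real]
      linarith
  have h2 := congrArg (fun v => inner ℝ v (a - b)) hst
  simp only [_root_.smul_apply, one_apply_eq_self, inner_add_left, inner_smul_left,
    RCLike.conj_to_real, inner_zero_left] at h2
  have h3 := norm_cube_uniform_convexity a b
  have h4 : ‖a‖ ^ 2 = ‖b‖ ^ 2 + 2 * inner ℝ b (a - b) + ‖a - b‖ ^ 2 := by
    have := norm_add_sq_real b (a - b)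
    rwa [add_sub_cancel] at this
  have h5 : inner ℝ l a = inner ℝ l b + inner ℝ l (a - b) := by
    rw [← inner_add_right, add_sub_cancel]
  rw [hab, h, h, ← hb, ← ha, h4, h5]
  have := mul_le_mul_of_nonneg_left h3 (by positivity : 0 ≤ 16 * γ)
  linarith

/-- The estimate functions dominate the weighted function values at the iterates. -/
lemma IsRun.value_le_estimate (hf : ContDiff ℝ 2 f) (hc : ConvexOn ℝ Set.univ f) (hγ : 0 < γ)
    (hμu : 0 ≤ μu) (hLip : ∀ x x' : E n, ‖hessian f x - hessian f x'‖ ≤ γ * ‖x - x'‖)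
    (hrun : IsRun f γ (convexParams γ μu) x₀ T H x y w φ) (hacc : HessianAccuracy f μu T H w)
    (t : ℕ) (ht : t < T) (u : E n) :
    ((t : ℝ) + 1) * (t + 2) * (t + 3) / 6 * f (x (t + 1)) ≤ φ (t + 1) u := by
  obtain ⟨μ, hμ⟩ := hacc
  induction t generalizing u with
  | zero =>
    rw [zero_add, hrun.estimate_one]
    have : 0 ≤ 2 * μu * ‖u - x₀‖ ^ 2 := by positivity
    have : 0 ≤ 16 * γ * ‖u - x₀‖ ^ 3 := by positivity
    push_cast
    linarith
  | succ t ih =>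
    have ih := ih (by omega) (y (t + 1))
    have hgrow := hrun.estimate_growth hγ t (by omega) u
    obtain ⟨hμ0, hμ1, h₁, h₂⟩ := hμ (t + 1) ht
    have hxmin : IsMinOn (cubicModel f (H (t + 1)) (4 * γ) (w (t + 1))) Set.univ (x (t + 2)) :=
      hrun.x_succ (t + 1) (by omega) ht
    have hw : w (t + 1) = (1 - 3 / ((t : ℝ) + 4)) • x (t + 1)
        + (3 / ((t : ℝ) + 4)) • y (t + 1) := by
      rw [hrun.w_eq (t + 1) (by omega) ht]
      simp only [convexParams]
      push_cast
      have : (t : ℝ) + 1 + 3 = t + 4 := by ring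
      rw [this]
    -- The test vector is `α (u - y)`: moving `w` by it replaces `y` by `u` in the convex
    -- combination.
    have hkey := cubic_step_key hf hγ hLip hμ0 h₁ h₂ hxmin ((3 / ((t : ℝ) + 4)) • (u - y (t + 1)))
    have hgi := gradient_inequality hf hc (x (t + 2)) (x (t + 1))
    rw [hrun.estimate_succ ht]
    set g := ∇ f (x (t + 2))
    set v := u - y (t + 1) with hv
    have ht0 : (0 : ℝ) ≤ t := t.cast_nonneg
    set τ : ℝ := (t : ℝ)
    have e1 : inner ℝ g (w (t + 1) - x (t + 2)) + inner ℝ g ((3 / (τ + 4)) • v)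
        = (1 - 3 / (τ + 4)) * inner ℝ g (x (t + 1) - x (t + 2))
          + 3 / (τ + 4) * inner ℝ g (u - x (t + 2)) := by
      rw [← inner_add_right, ← inner_smul_right, ← inner_smul_right, ← inner_add_right, hw, hv]
      congr 1
      module
    rw [e1, norm_smul, Real.norm_eq_abs, abs_of_nonneg (by positivity)] at hkey
    -- Scaling by `1/A_{t+1}` makes the weights of the linear terms `1/A_t` and `α_{t+1}/A_{t+1}`.
    -- The remaining coefficients are at most `μu (t+2)` and `8γ`, exactly those supplied by
    -- `estimate_growth`.
    have hkey2 : 0 ≤ (τ + 1) * (τ + 2) * (τ + 3) / 6 * inner ℝ g (x (t + 1) - x (t + 2))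
        + (τ + 2) * (τ + 3) / 2 * inner ℝ g (u - x (t + 2))
        + (τ + 2) * (τ + 3) / (τ + 4) * μ (t + 1) * ‖v‖ ^ 2
        + 8 * γ * ((τ + 2) * (τ + 3) / (τ + 4) ^ 2) * ‖v‖ ^ 3 := by
      have := mul_nonneg (by positivity : 0 ≤ (τ + 2) * (τ + 3) * (τ + 4) / 6) hkey
      refine this.trans (le_of_eq ?_)
      field_simp
      ring
    have q1 : (τ + 2) * (τ + 3) / (τ + 4) ≤ τ + 2 := by
      rw [div_le_iff₀ (by positivity)]; nlinarith
    have q2 : (τ + 2) * (τ + 3) / (τ + 4) ^ 2 ≤ 1 := by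
      rw [div_le_one (by positivity)]; nlinarith
    have q3 : (τ + 2) * (τ + 3) / (τ + 4) * μ (t + 1) * ‖v‖ ^ 2 ≤ μu * (τ + 2) * ‖v‖ ^ 2 := by
      refine mul_le_mul_of_nonneg_right ?_ (sq_nonneg _)
      rw [mul_comm μu]
      exact mul_le_mul q1 hμ1 hμ0 (by positivity)
    have q4 : 8 * γ * ((τ + 2) * (τ + 3) / (τ + 4) ^ 2) * ‖v‖ ^ 3 ≤ 8 * γ * ‖v‖ ^ 3 := by
      refine mul_le_mul_of_nonneg_right ?_ (by positivity)
      nlinarith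
    have q5 := mul_le_mul_of_nonneg_left hgi
      (by positivity : 0 ≤ (τ + 1) * (τ + 2) * (τ + 3) / 6)
    have q6 : 0 ≤ μu * ‖u - x₀‖ ^ 2 := by positivity
    have q7 : (((t + 1 : ℕ) : ℝ) + 1) * ((t + 1 : ℕ) + 2) * ((t + 1 : ℕ) + 3) / 6 * f (x (t + 2))
        = (τ + 1) * (τ + 2) * (τ + 3) / 6 * f (x (t + 2))
          + (τ + 2) * (τ + 3) / 2 * f (x (t + 2)) := by
      push_cast; ring
    change _ * f (x (t + 2)) ≤ _
    rw [q7]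
    linarith

/-- Each linearization lies below `f`, and the weights sum to `1/A_t`. The constants come from the
first step: `5/2 = 2 + 1/2` and `49/3 = 16 + 1/3`. -/
lemma IsRun.estimate_le (hf : ContDiff ℝ 2 f) (hc : ConvexOn ℝ Set.univ f)
    (hLip : ∀ x x' : E n, ‖hessian f x - hessian f x'‖ ≤ γ * ‖x - x'‖)
    (hrun : IsRun f γ (convexParams γ μu) x₀ T H x y w φ) (hacc : HessianAccuracy f μu T H w)
    (t : ℕ) (ht : t < T) (u : E n) :
    φ (t + 1) u ≤ ((t : ℝ) + 1) * (t + 2) * (t + 3) / 6 * f u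
      + μu * (t + 5 / 2) * ‖u - x₀‖ ^ 2 + 49 / 3 * γ * ‖u - x₀‖ ^ 3 := by
  induction t with
  | zero =>
    obtain ⟨μ, hμ⟩ := hacc
    obtain ⟨hμ0, hμ1, h₁, h₂⟩ := hμ 0 ht
    rw [hrun.w_zero] at h₁ h₂
    have q1 := le_cubicModel hf hLip hμ0 h₁ (x 1)
    have q2 : cubicModel f (H 0) γ x₀ (x 1) ≤ cubicModel f (H 0) γ x₀ u :=
      hrun.x_one (Set.mem_univ _)
    have q3 := cubicModel_le hf hLip h₂ u
    have q4 := mul_le_mul_of_nonneg_right hμ1 (sq_nonneg ‖u - x₀‖)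
    rw [zero_add, hrun.estimate_one]
    push_cast
    linarith
  | succ t ih =>
    have ih := ih (by omega)
    have q1 := mul_le_mul_of_nonneg_left (gradient_inequality hf hc (x (t + 2)) u)
      (by positivity : 0 ≤ ((t : ℝ) + 2) * (t + 3) / 2)
    rw [hrun.estimate_succ ht]
    push_cast
    linarith

/-- Convergence rate of a single run with the convex parameters. -/
lemma IsRun.rate (hf : ContDiff ℝ 2 f) (hc : ConvexOn ℝ Set.univ f) (hγ : 0 < γ)
    (hμu : 0 ≤ μu) (hLip : ∀ x x' : E n, ‖hessian f x - hessian f x'‖ ≤ γ * ‖x - x'‖)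
    (hrun : IsRun f γ (convexParams γ μu) x₀ T H x y w φ) (hacc : HessianAccuracy f μu T H w)
    {t : ℕ} (ht : 1 ≤ t) (htT : t ≤ T) (u : E n) :
    f (x t) - f u ≤ 6 * μu * ‖x₀ - u‖ ^ 2 / (t : ℝ) ^ 2 + 98 * γ * ‖x₀ - u‖ ^ 3 / (t : ℝ) ^ 3 := by
  obtain ⟨t, rfl⟩ : ∃ k, t = k + 1 := ⟨t - 1, by omega⟩
  have h1 := hrun.value_le_estimate hf hc hγ hμu hLip hacc t htT u
  have h2 := hrun.estimate_le hf hc hLip hacc t htT u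
  rw [norm_sub_rev x₀ u]
  have hR := norm_nonneg (u - x₀)
  set R := ‖u - x₀‖
  have ht0 : (0 : ℝ) ≤ t := t.cast_nonneg
  push_cast
  set τ : ℝ := (t : ℝ)
  have h3 : f (x (t + 1)) - f u ≤ 6 * μu * R ^ 2 * ((τ + 5 / 2) / ((τ + 1) * (τ + 2) * (τ + 3)))
      + 98 * γ * R ^ 3 * (1 / ((τ + 1) * (τ + 2) * (τ + 3))) := by
    have h4 : (τ + 1) * (τ + 2) * (τ + 3) / 6 * (f (x (t + 1)) - f u)
        ≤ μu * (τ + 5 / 2) * R ^ 2 + 49 / 3 * γ * R ^ 3 := by linarith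
    have h5 : 0 < (τ + 1) * (τ + 2) * (τ + 3) / 6 := by positivity
    rw [← le_div_iff₀' h5] at h4
    refine h4.trans (le_of_eq ?_)
    field_simp
    ring
  have h6 : (τ + 5 / 2) / ((τ + 1) * (τ + 2) * (τ + 3)) ≤ 1 / (τ + 1) ^ 2 := by
    rw [div_le_div_iff₀ (by positivity) (by positivity)]
    nlinarith [mul_nonneg ht0 ht0]
  have h7 : 1 / ((τ + 1) * (τ + 2) * (τ + 3)) ≤ 1 / (τ + 1) ^ 3 := by
    apply one_div_le_one_div_of_le (by positivity)
    nlinarith [mul_nonneg ht0 ht0]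
  have h8 := mul_le_mul_of_nonneg_left h6 (by positivity : 0 ≤ 6 * μu * R ^ 2)
  have h9 := mul_le_mul_of_nonneg_left h7 (by positivity : 0 ≤ 98 * γ * R ^ 3)
  rw [mul_one_div] at h3 h8
  rw [mul_one_div, mul_one_div] at h9
  linarith

end EstimateFunctions

/-! ### Restarting, contraction and iteration counts. -/

section Stages

variable {n : ℕ} {f : E n → ℝ} {lam γ μu R₀ : ℝ}

lemma rpow_third_cube {a : ℝ} (ha : 0 ≤ a) : (a ^ (1 / 3 : ℝ)) ^ 3 = a := by
  rw [← Real.rpow_natCast, ← Real.rpow_mul ha]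
  norm_num

lemma radius_pos (hR₀ : 0 < R₀) (s : ℕ) : 0 < radius R₀ s := by
  unfold radius; positivity

lemma radius_succ (R₀ : ℝ) (s : ℕ) : radius R₀ (s + 1) = radius R₀ s / 2 := by
  unfold radius; rw [pow_succ]; field_simp

/-- Here `1568 = 8 · 196 = 16 · 98`, so the cubic term of the rate falls below `λ D²/16`;
`sq_le_stageIterations` does the same for the quadratic term with `96 = 16 · 6`. -/
lemma cube_le_stageIterations (hlam : 0 < lam) (hγ : 0 < γ) (hR₀ : 0 < R₀) (s : ℕ) :
    1568 * γ * radius R₀ s / lam ≤ (stageIterations γ lam μu R₀ (s + 1) : ℝ) ^ 3 := by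
  have hR := radius_pos hR₀ s
  have h1 : 2 * (196 * γ * radius R₀ s / lam) ^ (1 / 3 : ℝ)
      ≤ stageIterations γ lam μu R₀ (s + 1) :=
    (mul_le_mul_of_nonneg_left (le_max_left _ _) zero_le_two).trans (Nat.le_ceil _)
  have h2 := pow_le_pow_left₀ (by positivity) h1 3
  rw [mul_pow, rpow_third_cube (by positivity)] at h2
  refine le_trans (le_of_eq ?_) h2
  ring

lemma sq_le_stageIterations (hlam : 0 < lam) (hμu : 0 ≤ μu) (s : ℕ) :
    96 * μu / lam ≤ (stageIterations γ lam μu R₀ (s + 1) : ℝ) ^ 2 := by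
  have h1 : 2 * (2 * √(6 * μu / lam)) ≤ stageIterations γ lam μu R₀ (s + 1) :=
    (mul_le_mul_of_nonneg_left (le_max_right _ _) zero_le_two).trans (Nat.le_ceil _)
  have h2 := pow_le_pow_left₀ (by positivity) h1 2
  rw [mul_pow, mul_pow, Real.sq_sqrt (by positivity)] at h2
  refine le_trans (le_of_eq ?_) h2
  ring

lemma stageIterations_pos (hlam : 0 < lam) (hγ : 0 < γ) (hR₀ : 0 < R₀) (s : ℕ) :
    0 < stageIterations γ lam μu R₀ (s + 1) := by
  have hR := radius_pos hR₀ s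
  have h := cube_le_stageIterations (μu := μu) hlam hγ hR₀ s
  have h' : 0 < 1568 * γ * radius R₀ s / lam := by positivity
  rcases Nat.eq_zero_or_pos (stageIterations γ lam μu R₀ (s + 1)) with h0 | h0
  · rw [h0] at h
    norm_num at h
    linarith
  · exact h0

/-- One stage of the method, started within distance `R_s` of the minimizer. -/
lemma stage_gap_le (hlam : 0 < lam) (hγ : 0 < γ) (hμu : 0 ≤ μu) (hR₀ : 0 < R₀)
    (hf : ContDiff ℝ 2 f) (hconv : StrongConvexOn Set.univ lam f)
    (hLip : ∀ x x' : E n, ‖hessian f x - hessian f x'‖ ≤ γ * ‖x - x'‖)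
    {xs : E n} {z : ℕ → E n} (hz : IsMultiStage f γ lam μu R₀ z) (s : ℕ)
    (hs : ‖z s - xs‖ ≤ radius R₀ s) :
    f (z (s + 1)) - f xs ≤ lam / 8 * ‖z s - xs‖ ^ 2 := by
  obtain ⟨H, x, y, w, φ, hrun, hacc, hzs⟩ := hz (s + 1) (by omega)
  have hc : ConvexOn ℝ Set.univ f :=
    UniformConvexOn.convexOn hconv fun r => by simp only [Pi.zero_apply]; positivity
  have hN := stageIterations_pos (μu := μu) hlam hγ hR₀ s
  have h1 := hrun.rate hf hc hγ hμu hLip hacc hN le_rfl xs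
  rw [← hzs, add_tsub_cancel_right] at h1
  have h2 := cube_le_stageIterations (μu := μu) hlam hγ hR₀ s
  have h3 := sq_le_stageIterations (γ := γ) (R₀ := R₀) hlam hμu s
  have hN' : (0 : ℝ) < stageIterations γ lam μu R₀ (s + 1) := by exact_mod_cast hN
  set N : ℝ := (stageIterations γ lam μu R₀ (s + 1) : ℝ)
  set D := ‖z s - xs‖
  have hD : 0 ≤ D := norm_nonneg _
  rw [div_le_iff₀ hlam] at h2 h3
  have h4 : 6 * μu * D ^ 2 / N ^ 2 ≤ lam / 16 * D ^ 2 := by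
    rw [div_le_iff₀ (by positivity)]
    nlinarith [mul_le_mul_of_nonneg_right h3 (sq_nonneg D)]
  have h5 : 98 * γ * D ^ 3 / N ^ 3 ≤ lam / 16 * D ^ 2 := by
    rw [div_le_iff₀ (by positivity)]
    -- The only place where the distance bound `D ≤ R_s` is needed; the quadratic term scales
    -- without it.
    have h6 : 1568 * γ * D ≤ N ^ 3 * lam :=
      (mul_le_mul_of_nonneg_left hs (by positivity)).trans h2
    nlinarith [mul_le_mul_of_nonneg_right h6 (sq_nonneg D)]
  linarith

lemma distance_le_radius (hlam : 0 < lam) (hγ : 0 < γ) (hμu : 0 ≤ μu) (hR₀ : 0 < R₀)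
    (hf : ContDiff ℝ 2 f) (hconv : StrongConvexOn Set.univ lam f)
    (hLip : ∀ x x' : E n, ‖hessian f x - hessian f x'‖ ≤ γ * ‖x - x'‖)
    {xs : E n} (hxs : IsMinOn f Set.univ xs) {z : ℕ → E n} (hz₀ : ‖z 0 - xs‖ ≤ R₀)
    (hz : IsMultiStage f γ lam μu R₀ z) (s : ℕ) : ‖z s - xs‖ ≤ radius R₀ s := by
  induction s with
  | zero => simpa [radius] using hz₀
  | succ s ih =>
    have h1 := stage_gap_le hlam hγ hμu hR₀ hf hconv hLip hz s ih
    have h2 := quadratic_growth hconv hxs (z (s + 1))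
    have h3 : lam / 2 * ‖z (s + 1) - xs‖ ^ 2 ≤ lam / 2 * (‖z s - xs‖ / 2) ^ 2 := by
      refine (h2.trans h1).trans (le_of_eq ?_)
      ring
    have h4 := le_of_mul_le_mul_left h3 (by positivity)
    have h5 := le_of_sq_le_sq h4 (by positivity)
    rw [radius_succ]
    linarith

lemma gap_le (hlam : 0 < lam) (hγ : 0 < γ) (hμu : 0 ≤ μu) (hR₀ : 0 < R₀)
    (hf : ContDiff ℝ 2 f) (hconv : StrongConvexOn Set.univ lam f)
    (hLip : ∀ x x' : E n, ‖hessian f x - hessian f x'‖ ≤ γ * ‖x - x'‖)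
    {xs : E n} (hxs : IsMinOn f Set.univ xs) {z : ℕ → E n} (hz₀ : ‖z 0 - xs‖ ≤ R₀)
    (hz : IsMultiStage f γ lam μu R₀ z) (s : ℕ) :
    f (z s) - f xs ≤ (1 / 4) ^ s * (f (z 0) - f xs) := by
  induction s with
  | zero => simp
  | succ s ih =>
    have h1 := stage_gap_le hlam hγ hμu hR₀ hf hconv hLip hz s
      (distance_le_radius hlam hγ hμu hR₀ hf hconv hLip hxs hz₀ hz s)
    have h2 := quadratic_growth hconv hxs (z s)
    rw [pow_succ]
    linarith

lemma gap_numStages_le {Δ ε : ℝ} (hε : 0 < ε) :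
    (1 / 4) ^ numStages Δ ε * Δ ≤ ε := by
  rcases le_or_gt Δ 0 with hΔ | hΔ
  · exact (mul_nonpos_of_nonneg_of_nonpos (by positivity) hΔ).trans hε.le
  · have h1 : Real.logb 4 (Δ / ε) ≤ numStages Δ ε := Nat.le_ceil _
    rw [Real.logb_le_iff_le_rpow (by norm_num) (by positivity), Real.rpow_natCast,
      div_le_iff₀ hε] at h1
    rw [one_div, inv_pow, inv_mul_le_iff₀ (by positivity)]
    exact h1

lemma stageLength_succ_le (hlam : 0 < lam) (hγ : 0 < γ) (hR₀ : 0 < R₀) (s : ℕ) :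
    stageLength γ lam μu R₀ (s + 1)
      ≤ 2 * (196 * γ * R₀ / lam) ^ (1 / 3 : ℝ) * ((1 / 2 : ℝ) ^ (1 / 3 : ℝ)) ^ s
        + 4 * √(6 * μu / lam) := by
  have h1 : (196 * γ * radius R₀ s / lam) ^ (1 / 3 : ℝ)
      = (196 * γ * R₀ / lam) ^ (1 / 3 : ℝ) * ((1 / 2 : ℝ) ^ (1 / 3 : ℝ)) ^ s := by
    have e : 196 * γ * radius R₀ s / lam = (196 * γ * R₀ / lam) * (1 / 2) ^ s := by
      unfold radius; rw [one_div, inv_pow]; ring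
    rw [e, Real.mul_rpow (by positivity) (by positivity)]
    congr 1
    rw [← Real.rpow_natCast, ← Real.rpow_natCast, ← Real.rpow_mul (by norm_num),
      ← Real.rpow_mul (by norm_num), mul_comm]
  have h2 : max ((196 * γ * radius R₀ s / lam) ^ (1 / 3 : ℝ)) (2 * √(6 * μu / lam))
      ≤ (196 * γ * radius R₀ s / lam) ^ (1 / 3 : ℝ) + 2 * √(6 * μu / lam) :=
    have hR := radius_pos hR₀ s
    max_le_add_of_nonneg (by positivity) (by positivity)
  simp only [stageLength, add_tsub_cancel_right]
  rw [h1] at h2 ⊢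
  linarith

lemma sum_stageLength_le (hlam : 0 < lam) (hγ : 0 < γ) (hR₀ : 0 < R₀) (S : ℕ) :
    ∑ s ∈ Finset.Icc 1 S, stageLength γ lam μu R₀ s
      ≤ 8 * (392 * γ * R₀ / lam) ^ (1 / 3 : ℝ) + 4 * √(6 * μu / lam) * S := by
  set q : ℝ := (1 / 2 : ℝ) ^ (1 / 3 : ℝ) with hq
  set c : ℝ := (196 * γ * R₀ / lam) ^ (1 / 3 : ℝ) with hc
  have hc0 : 0 ≤ c := by positivity
  have hq0 : 0 < q := by positivity
  have hq3 : q ^ 3 = 1 / 2 := rpow_third_cube (by norm_num)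
  -- This is equivalent to `1/(1-q) ≤ 4/q`. The factor `1/q = 2^(1/3)` turns `196` into `392`.
  have hq1 : q ≤ 4 / 5 := by
    refine le_of_pow_le_pow_left₀ (n := 3) (by norm_num) (by norm_num) ?_
    rw [hq3]; norm_num
  have h392 : (392 * γ * R₀ / lam) ^ (1 / 3 : ℝ) = c / q := by
    rw [hc, hq, ← Real.div_rpow (by positivity) (by norm_num)]
    congr 1
    ring
  have hsum : ∑ s ∈ Finset.Icc 1 S, stageLength γ lam μu R₀ s
      = ∑ s ∈ Finset.range S, stageLength γ lam μu R₀ (s + 1) := by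
    rw [← Finset.Ico_add_one_right_eq_Icc, Finset.sum_Ico_eq_sum_range]
    simp [add_comm]
  have hgeom : ∑ s ∈ Finset.range S, q ^ s ≤ 4 / q := by
    have h1 : ∑ s ∈ Finset.range S, q ^ s ≤ 1 / (1 - q) := by
      have h := mul_neg_geom_sum q S
      rw [le_div_iff₀ (by linarith), mul_comm, h]
      linarith [pow_nonneg hq0.le S]
    refine h1.trans ?_
    rw [div_le_div_iff₀ (by linarith) hq0]
    linarith
  rw [hsum, h392]
  calc ∑ s ∈ Finset.range S, stageLength γ lam μu R₀ (s + 1)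
      ≤ ∑ s ∈ Finset.range S, (2 * c * q ^ s + 4 * √(6 * μu / lam)) :=
        Finset.sum_le_sum fun s _ => stageLength_succ_le hlam hγ hR₀ s
    _ = 2 * c * ∑ s ∈ Finset.range S, q ^ s + 4 * √(6 * μu / lam) * S := by
        rw [Finset.sum_add_distrib, ← Finset.mul_sum, Finset.sum_const, Finset.card_range,
          nsmul_eq_mul]
        ring
    _ ≤ 2 * c * (4 / q) + 4 * √(6 * μu / lam) * S := by gcongr
    _ = 8 * (c / q) + 4 * √(6 * μu / lam) * S := by ring

lemma sum_stageIterations_le (S : ℕ) :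
    ((∑ s ∈ Finset.Icc 1 S, stageIterations γ lam μu R₀ s : ℕ) : ℝ)
      ≤ ∑ s ∈ Finset.Icc 1 S, stageLength γ lam μu R₀ s + S := by
  have h : ∀ s ∈ Finset.Icc 1 S, (stageIterations γ lam μu R₀ s : ℝ)
      ≤ stageLength γ lam μu R₀ s + 1 := fun s _ => by
    refine (Nat.ceil_lt_add_one ?_).le
    exact mul_nonneg zero_le_two (le_max_of_le_right (by positivity))
  push_cast
  refine (Finset.sum_le_sum h).trans ?_
  simp [Finset.sum_add_distrib]

/-- The assumption makes the logarithm to base 4 at least 1, so rounding up at most doubles it; and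
`1/ln 4 ≤ 3/4`. -/
lemma numStages_le {Δ ε : ℝ} (hε : 0 < ε) (h : ε ≤ Δ / 4) :
    (numStages Δ ε : ℝ) ≤ 3 / 2 * Real.log (Δ / ε) := by
  have h4 : 4 ≤ Δ / ε := by rw [le_div_iff₀ hε]; linarith
  have hlog4 : Real.log 4 = 2 * Real.log 2 := by
    rw [show (4 : ℝ) = 2 ^ 2 by norm_num, Real.log_pow]; norm_num
  have h1 : 1 ≤ Real.logb 4 (Δ / ε) := by
    rw [Real.le_logb_iff_rpow_le (by norm_num) (by linarith)]
    simpa using h4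
  have h2 : (numStages Δ ε : ℝ) ≤ Real.logb 4 (Δ / ε) + 1 :=
    (Nat.ceil_lt_add_one (by linarith)).le
  have h3 : Real.logb 4 (Δ / ε) ≤ 3 / 4 * Real.log (Δ / ε) := by
    have hl : 0 ≤ Real.log (Δ / ε) := Real.log_nonneg (by linarith)
    have := Real.log_two_gt_d9
    rw [Real.logb, hlog4, div_le_iff₀ (by linarith)]
    nlinarith
  linarith

/-- The constant 60 is `8 · 15/2`, from `392^(1/3) ≤ 15/2`. The square-root term needs only `4 · 5/2
· 3/2 = 15`. -/
lemma leading_terms_le (hlam : 0 < lam) (hγ : 0 < γ) (hR₀ : 0 < R₀)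
    {S L : ℝ} (hL : 0 ≤ L) (hSL : S ≤ 3 / 2 * L) :
    8 * (392 * γ * R₀ / lam) ^ (1 / 3 : ℝ) + 4 * √(6 * μu / lam) * S
      ≤ 60 * (√(μu / lam) * L + (γ * R₀ / lam) ^ (1 / 3 : ℝ)) := by
  have h1 : (392 * γ * R₀ / lam) ^ (1 / 3 : ℝ)
      = (392 : ℝ) ^ (1 / 3 : ℝ) * (γ * R₀ / lam) ^ (1 / 3 : ℝ) := by
    rw [← Real.mul_rpow (by norm_num) (by positivity)]
    congr 1
    ring
  have h2 : (392 : ℝ) ^ (1 / 3 : ℝ) ≤ 15 / 2 := by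
    refine le_of_pow_le_pow_left₀ (n := 3) (by norm_num) (by norm_num) ?_
    rw [rpow_third_cube (by norm_num)]; norm_num
  have h3 : √(6 * μu / lam) ≤ 5 / 2 * √(μu / lam) := by
    rw [mul_div_assoc, Real.sqrt_mul (by norm_num)]
    exact mul_le_mul_of_nonneg_right (Real.sqrt_le_iff.2 (by norm_num)) (Real.sqrt_nonneg _)
  have h4 : √(6 * μu / lam) * S ≤ 5 / 2 * √(μu / lam) * (3 / 2 * L) :=
    (mul_le_mul_of_nonneg_left hSL (Real.sqrt_nonneg _)).trans
      (mul_le_mul_of_nonneg_right h3 (by positivity))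
  have h5 := mul_le_mul_of_nonneg_right h2
    (Real.rpow_nonneg (by positivity : 0 ≤ γ * R₀ / lam) (1 / 3 : ℝ))
  have h6 : 0 ≤ √(μu / lam) * L := by positivity
  rw [h1]
  linarith

end Stages

end AINCR

theorem mainTheorem6 {n : ℕ} (f : AINCR.E n → ℝ) (lam γ μu R₀ : ℝ)
    (hlam : 0 < lam) (hγ : 0 < γ) (hμu : 0 ≤ μu) (hR₀ : 0 < R₀)
    (hf : ContDiff ℝ 2 f) (hconv : StrongConvexOn Set.univ lam f)
    (hLip : ∀ x x' : AINCR.E n,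
      ‖AINCR.hessian f x - AINCR.hessian f x'‖ ≤ γ * ‖x - x'‖)
    (xstar : AINCR.E n) (hxstar : IsMinOn f Set.univ xstar)
    (z : ℕ → AINCR.E n) (hz₀ : ‖z 0 - xstar‖ ≤ R₀)
    (hz : AINCR.IsMultiStage f γ lam μu R₀ z) :
    (∀ s, ‖z s - xstar‖ ^ 2 ≤ (1 / 2) ^ s * R₀ ^ 2) ∧
    (∀ s, f (z s) - f xstar ≤ (1 / 4) ^ s * (f (z 0) - f xstar)) ∧
    (∀ ε : ℝ, 0 < ε → ∀ S : ℕ, S = AINCR.numStages (f (z 0) - f xstar) ε →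
      f (z S) - f xstar ≤ ε ∧
      ∑ s ∈ Finset.Icc 1 S, AINCR.stageLength γ lam μu R₀ s
        ≤ 8 * (392 * γ * R₀ / lam) ^ (1 / 3 : ℝ) + 4 * √(6 * μu / lam) * S ∧
      ((∑ s ∈ Finset.Icc 1 S, AINCR.stageIterations γ lam μu R₀ s : ℕ) : ℝ)
        ≤ 8 * (392 * γ * R₀ / lam) ^ (1 / 3 : ℝ) + 4 * √(6 * μu / lam) * S + S ∧
      (ε ≤ (f (z 0) - f xstar) / 4 →
        ∑ s ∈ Finset.Icc 1 S, AINCR.stageLength γ lam μu R₀ s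
          ≤ 60 * (√(μu / lam) * Real.log ((f (z 0) - f xstar) / ε)
              + (γ * R₀ / lam) ^ (1 / 3 : ℝ)) ∧
        ((∑ s ∈ Finset.Icc 1 S, AINCR.stageIterations γ lam μu R₀ s : ℕ) : ℝ)
          ≤ 60 * ((√(μu / lam) + 1) * Real.log ((f (z 0) - f xstar) / ε)
              + (γ * R₀ / lam) ^ (1 / 3 : ℝ)))) := by
  have hdist := AINCR.distance_le_radius hlam hγ hμu hR₀ hf hconv hLip hxstar hz₀ hz
  have hgap := AINCR.gap_le hlam hγ hμu hR₀ hf hconv hLip hxstar hz₀ hz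
  refine ⟨fun s => ?_, hgap, fun ε hε S hS => ?_⟩
  · have h1 := pow_le_pow_left₀ (norm_nonneg _) (hdist s) 2
    refine h1.trans ?_
    -- Halving the distance gives the factor `(1/4)^s`, stronger than the required `(1/2)^s`.
    have h2 : AINCR.radius R₀ s ^ 2 = (1 / 4) ^ s * R₀ ^ 2 := by
      have h4 : (4 : ℝ) ^ s = (2 ^ s) ^ 2 := by rw [← pow_mul, mul_comm, pow_mul]; norm_num
      rw [AINCR.radius, div_pow, one_div, inv_pow, h4]
      ring
    rw [h2]
    gcongr
    norm_num
  · have hsum := AINCR.sum_stageLength_le (μu := μu) hlam hγ hR₀ S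
    have hit := AINCR.sum_stageIterations_le (γ := γ) (lam := lam) (μu := μu) (R₀ := R₀) S
    refine ⟨?_, hsum, by linarith, fun hεΔ => ?_⟩
    · rw [hS]
      exact (hgap _).trans (AINCR.gap_numStages_le hε)
    · have hSL := AINCR.numStages_le hε hεΔ
      rw [← hS] at hSL
      have hL : 0 ≤ Real.log ((f (z 0) - f xstar) / ε) := by
        have : (0 : ℝ) ≤ S := S.cast_nonneg
        linarith
      have hlead := AINCR.leading_terms_le (μu := μu) hlam hγ hR₀ hL hSL
      exact ⟨hsum.trans hlead, by linarith⟩
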